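/- Let $X$ be a complex Banach space and let $T$ be a closed (not necessarily densely defined) linear operator in $X$ with domain $D(T)$. Let $\rho(T)$ be the set of $z\in\mathbb{C}$ for which $T-z:D(T)\to X$ is a bijection with bounded inverse, and let $\sigma(T)=\mathbb{C}\setminus\rho(T)$. If $z\in\mathbb{C}$ is not a limit point of $\sigma(T)$, its algebraic multiplicity is the dimension of the range of the Riesz projection $$P_z=-\frac{1}{2\pi i}\oint_{|\zeta-z|=r}(T-\zeta)^{-1}\,d\zeta ,$$ where $r>0$ is such that $\{\zeta : 0<|\zeta-z|\le r\}\subset\rho(T)$ (it does not depend on the choice of $r$). The discrete spectrum $\sigma_{\mathrm{disc}}(T)$ is the set of isolated points of $\sigma(T)$ with finite algebraic multiplicity. The operator $T-z$ is Fredholm if its range is closed and both $\operatorname{nul}(T-z)=\dim\ker(T-z)$ and $\operatorname{def}(T-z)=\dim\big(X/\operatorname{ran}(T-z)\big)$ are finite; its index is then $\operatorname{ind}(T-z)=\operatorname{nul}(T-z)-\operatorname{def}(T-z)$. Let $$\sigma_{\mathrm{ess},5}(T)=\mathbb{C}\setminus\{z : T-z \text{ is Fredholm with } \operatorname{ind}(T-z)=0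 \text{ and a deleted neighborhood of } z \text{ is in } \rho(T)\},$$ $$\sigma_{\mathrm{ess},B}(T)=\mathbb{C}\setminus\{z : \operatorname{ran}(T-z)\text{ is closed, } z \text{ is not a limit point of } \sigma(T) \text{ and is of finite algebraic multiplicity}\}.$$ Then: 1. $\sigma_{\mathrm{disc}}(T)=\{\lambda : \lambda \text{ is an isolated point of } \sigma(T) \text{ such that } T-\lambda \text{ is Fredholm with } \operatorname{ind}(T-\lambda)=0\}$. 2. $\sigma_{\mathrm{ess},5}(T)=\sigma(T)\setminus\sigma_{\mathrm{disc}}(T)$. 3. Browder's essential spectrum agrees with these: $\sigma_{\mathrm{ess},B}(T)=\sigma_{\mathrm{ess},5}(T)$. The same equality holds if in the definition of $\sigma_{\mathrm{ess},B}(T)$ "finite algebraic multiplicity" is read as finite dimension of the generalized null space $\bigcup_{n\ge 1}\ker\big((T-z)^n\big)$. -/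

import Mathlib

open Filter Topology

namespace ClosedOperator

noncomputable section

variable {X : Type*} [NormedAddCommGroup X] [NormedSpace ℂ X]

/-- The operator `T - z` with domain `D(T)`, as a linear map `D(T) → X`. -/
def shift (T : X →ₗ.[ℂ] X) (z : ℂ) : T.domain →ₗ[ℂ] X :=
  T.toFun - z • T.domain.subtype

/-- `R` is a bounded two-sided inverse of `T - z : D(T) → X`. -/
def IsBoundedInverse (T : X →ₗ.[ℂ] X) (z : ℂ) (R : X →L[ℂ] X) : Prop :=
  (∀ x : X, ∃ h : R x ∈ T.domain, shift T z ⟨R x, h⟩ = x) ∧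
    ∀ x : T.domain, R (shift T z x) = x

/-- The resolvent set: all `z` such that `T - z` is boundedly invertible. -/
def rho (T : X →ₗ.[ℂ] X) : Set ℂ :=
  {z | ∃ R : X →L[ℂ] X, IsBoundedInverse T z R}

/-- The spectrum. -/
def sigma (T : X →ₗ.[ℂ] X) : Set ℂ := (rho T)ᶜ

open Classical in
/-- The resolvent `(T - z)⁻¹` for `z` in the resolvent set (and `0` elsewhere). -/
def resolventOp (T : X →ₗ.[ℂ] X) (z : ℂ) : X →L[ℂ] X :=
  if h : ∃ R : X →L[ℂ] X, IsBoundedInverse T z R then h.choose else 0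

/-- The set of isolated points of the spectrum. -/
def isolatedSpectrum (T : X →ₗ.[ℂ] X) : Set ℂ :=
  {z | z ∈ sigma T ∧ ¬ AccPt z (𝓟 (sigma T))}

/-- The Riesz integral `-(2πi)⁻¹ ∮_{|z - c| = r} (T - z)⁻¹ dz`. It is the Riesz projection of `T`
at `c` when the closed disc of radius `r` about `c`, without its centre, lies in the resolvent
set. -/
def rieszProjection (T : X →ₗ.[ℂ] X) (c : ℂ) (r : ℝ) : X →L[ℂ] X :=
  -((2 * Real.pi * Complex.I : ℂ)⁻¹ • ∮ z in C(c, r), resolventOp T z)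

/-- `c` has finite algebraic multiplicity: the range of the Riesz projection at `c` is
finite-dimensional. Here `c` is an isolated point of the spectrum or a point of the resolvent set
(of multiplicity zero); by Cauchy's theorem the admissible radius does not matter. -/
def HasFiniteAlgMult (T : X →ₗ.[ℂ] X) (c : ℂ) : Prop :=
  ∃ r : ℝ, 0 < r ∧ Metric.closedBall c r \ {c} ⊆ rho T ∧
    FiniteDimensional ℂ (LinearMap.range (rieszProjection T c r : X →ₗ[ℂ] X))

/-- The discrete spectrum: isolated points of the spectrum of finite algebraic multiplicity. -/
def sigmaDisc (T : X →ₗ.[ℂ] X) : Set ℂ :=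
  {z | z ∈ isolatedSpectrum T ∧ HasFiniteAlgMult T z}

/-- The range of `T - z`. -/
def ran (T : X →ₗ.[ℂ] X) (z : ℂ) : Submodule ℂ X := LinearMap.range (shift T z)

/-- `T - z` is Fredholm: closed range, finite nullity and finite deficiency. -/
def IsFredholmAt (T : X →ₗ.[ℂ] X) (z : ℂ) : Prop :=
  IsClosed (ran T z : Set X) ∧ FiniteDimensional ℂ (LinearMap.ker (shift T z)) ∧
    FiniteDimensional ℂ (X ⧸ ran T z)

/-- The index `nul (T - z) - def (T - z)`, meaningful when `T - z` is Fredholm. -/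
def indexAt (T : X →ₗ.[ℂ] X) (z : ℂ) : ℤ :=
  (Module.finrank ℂ (LinearMap.ker (shift T z)) : ℤ) - Module.finrank ℂ (X ⧸ ran T z)

/-- All `z` such that `T - z` is Fredholm of index zero and a deleted neighbourhood of `z` is in the
resolvent set. -/
def Delta5 (T : X →ₗ.[ℂ] X) : Set ℂ :=
  {z | IsFredholmAt T z ∧ indexAt T z = 0 ∧ ∀ᶠ w in 𝓝[≠] z, w ∈ rho T}

def sigmaEss5 (T : X →ₗ.[ℂ] X) : Set ℂ := (Delta5 T)ᶜ

/-- All `z` such that `T - z` has closed range, `z` has finite algebraic multiplicity, and `z` is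
not a limit point of the spectrum. -/
def DeltaB (T : X →ₗ.[ℂ] X) : Set ℂ :=
  {z | IsClosed (ran T z : Set X) ∧ HasFiniteAlgMult T z ∧ ¬ AccPt z (𝓟 (sigma T))}

def sigmaEssB (T : X →ₗ.[ℂ] X) : Set ℂ := (DeltaB T)ᶜ

/-- The kernel of `(T - z) ^ n` (with the natural domain of the power). -/
def kerPow (T : X →ₗ.[ℂ] X) (z : ℂ) : ℕ → Submodule ℂ X
  | 0 => ⊥
  | n + 1 => ((kerPow T z n).comap (shift T z)).map T.domain.subtype

/-- The generalized null space, the union of the increasing kernels of the powers of `T - z`. -/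
def genKer (T : X →ₗ.[ℂ] X) (z : ℂ) : Submodule ℂ X := ⨆ n, kerPow T z n

/-- The variant of `DeltaB` in which finite algebraic multiplicity means that the generalized null
space of `T - z` is finite-dimensional. -/
def DeltaB' (T : X →ₗ.[ℂ] X) : Set ℂ :=
  {z | IsClosed (ran T z : Set X) ∧ FiniteDimensional ℂ (genKer T z) ∧
    ¬ AccPt z (𝓟 (sigma T))}

def sigmaEssB' (T : X →ₗ.[ℂ] X) : Set ℂ := (DeltaB' T)ᶜ

end

end ClosedOperator

/-!
If `R = (T - w)⁻¹` is bounded, then `S(ζ) = (T - ζ)(T - w)⁻¹ = 1 - (ζ - w) R` is a family of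
commuting bounded operators with the same range, index and generalized kernel as `T - ζ`, and `S(ζ)`
is invertible exactly when `ζ ∈ ρ(T)`. So if a deleted neighbourhood of `z` lies in `ρ(T)`, then
`S(z)` is a limit of invertible operators commuting with it. Three facts give the theorem.

* Let `S(z)` be Fredholm. Its restriction to the hyperrange `⋂ n, range (S(z) ^ n)` is surjective
  with finite-dimensional kernel, and a limit of injective operators, hence injective because right
  invertibility is stable. Therefore the hyperkernel `⋃ n, ker (S(z) ^ n)` is finite-dimensional.
* Let `S(z)` have closed range and finite-dimensional hyperkernel `N`. On `X ⧸ N` it is injective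
  with closed range and a limit of surjective operators, hence invertible. Therefore `S(z)` is
  Fredholm of index `0`; moreover the resolvent extends holomorphically to `z` modulo `N`, so by
  Cauchy's theorem the range of the Riesz projection `P` lies in `N`.
* Integrating the resolvent equation gives `L` commuting with `S(z)` such that `S(z) L = 1 - P`. If
  `P` has finite rank, then `S(z)` has closed range and its hyperkernel lies in the range of `P`.
-/

namespace ClosedOperator

section LinearAlgebra

theorem smul_geom_sum_smul_eq_of_pow_smul_eq_zero {A M : Type*} [Ring A] [AddCommGroup M]
    [Module A M] {p : A} {n : ℕ} {x : M} (hx : (1 - p) ^ n • x = 0) :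
    p • (∑ i ∈ Finset.range n, (1 - p) ^ i) • x = x := by
  have hgeom := mul_neg_geom_sum (1 - p) n
  rw [sub_sub_cancel] at hgeom
  rw [smul_smul, hgeom, sub_smul, hx, one_smul, sub_zero]

variable {K V : Type*} [Field K] [AddCommGroup V] [Module K V] {f g : Module.End K V}

theorem finiteDimensional_ker_pow [FiniteDimensional K (LinearMap.ker f)] (n : ℕ) :
    FiniteDimensional K (LinearMap.ker (f ^ n)) := by
  induction n with
  | zero => rw [pow_zero, Module.End.one_eq_id, LinearMap.ker_id]; infer_instance
  | succ n ih => rw [pow_succ, Module.End.mul_eq_comp, LinearMap.ker_comp]; infer_instance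

theorem cofg_range_pow (hf : (LinearMap.range f).CoFG) (n : ℕ) :
    (LinearMap.range (f ^ n)).CoFG := by
  induction n with
  | zero => rw [pow_zero, Module.End.one_eq_id, LinearMap.range_id]; exact .top
  | succ n ih => rw [pow_succ', Module.End.mul_eq_comp, LinearMap.range_comp]; infer_instance

/-- The hyperrange `⋂ n, range (f ^ n)` of a linear endomorphism. -/
def hyperrange (f : Module.End K V) : Submodule K V := ⨅ n : ℕ, LinearMap.range (f ^ n)

/-- The hyperkernel `⋃ n, ker (f ^ n)` of a linear endomorphism. -/
def hyperkernel (f : Module.End K V) : Submodule K V := f.maxGenEigenspace 0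

theorem mem_hyperrange {y : V} : y ∈ hyperrange f ↔ ∀ n : ℕ, ∃ x, (f ^ n) x = y := by
  simp only [hyperrange, Submodule.mem_iInf, LinearMap.mem_range]

theorem mem_hyperkernel {x : V} : x ∈ hyperkernel f ↔ ∃ n : ℕ, (f ^ n) x = 0 := by
  simp only [hyperkernel, Module.End.mem_maxGenEigenspace, zero_smul, sub_zero]

theorem map_mem_hyperrange (h : Commute f g) {y : V} (hy : y ∈ hyperrange f) :
    g y ∈ hyperrange f := by
  refine mem_hyperrange.2 fun n => ?_
  obtain ⟨x, rfl⟩ := mem_hyperrange.1 hy n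
  exact ⟨g x, LinearMap.congr_fun (h.pow_left n).eq x⟩

theorem map_mem_hyperkernel (h : Commute f g) {x : V} (hx : x ∈ hyperkernel f) :
    g x ∈ hyperkernel f :=
  Module.End.mapsTo_maxGenEigenspace_of_comm h 0 hx

theorem map_mem_hyperkernel_iff {x : V} : f x ∈ hyperkernel f ↔ x ∈ hyperkernel f := by
  refine ⟨fun hx => ?_, map_mem_hyperkernel (Commute.refl f)⟩
  obtain ⟨n, hn⟩ := mem_hyperkernel.1 hx
  exact mem_hyperkernel.2 ⟨n + 1, by rwa [pow_succ]⟩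

theorem exists_ker_inf_range_pow_le_hyperrange (f : Module.End K V)
    [FiniteDimensional K (LinearMap.ker f)] :
    ∃ n : ℕ, LinearMap.ker f ⊓ LinearMap.range (f ^ n) ≤ hyperrange f := by
  obtain ⟨n, hn⟩ := IsArtinian.monotone_stabilizes
    (OrderHom.comp ⟨fun p : (Submodule K V)ᵒᵈ =>
      OrderDual.toDual ((OrderDual.ofDual p).submoduleOf (LinearMap.ker f)), fun _ _ h =>
        Submodule.comap_mono h⟩ f.iterateRange)
  refine ⟨n, fun x ⟨hx, hxn⟩ => (Submodule.mem_iInf _).2 fun m => ?_⟩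
  rcases le_total n m with h | h
  · have hnm : (LinearMap.range (f ^ n)).submoduleOf (LinearMap.ker f) =
        (LinearMap.range (f ^ m)).submoduleOf (LinearMap.ker f) := hn m h
    exact (hnm ▸ hxn : (⟨x, hx⟩ : LinearMap.ker f) ∈
      (LinearMap.range (f ^ m)).submoduleOf (LinearMap.ker f))
  · exact f.iterateRange.monotone h hxn

theorem surjOn_hyperrange (f : Module.End K V) [FiniteDimensional K (LinearMap.ker f)] :
    Set.SurjOn f (hyperrange f) (hyperrange f) := by
  intro y hy
  obtain ⟨n, hn⟩ := exists_ker_inf_range_pow_le_hyperrange f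
  have exists_preimage (m : ℕ) : ∃ x ∈ LinearMap.range (f ^ m), f x = y := by
    obtain ⟨z, rfl⟩ := mem_hyperrange.1 hy (m + 1)
    exact ⟨(f ^ m) z, ⟨z, rfl⟩, by rw [pow_succ']; rfl⟩
  obtain ⟨x, hx, rfl⟩ := exists_preimage n
  refine ⟨x, (Submodule.mem_iInf _).2 fun m => ?_, rfl⟩
  rcases le_total n m with h | h
  · obtain ⟨x', hx', hxx'⟩ := exists_preimage m
    have hker : x - x' ∈ LinearMap.ker f := by simp [hxx']
    have hrange : x - x' ∈ LinearMap.range (f ^ n) :=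
      sub_mem hx (f.iterateRange.monotone h hx')
    simpa using add_mem ((Submodule.mem_iInf _).1 (hn ⟨hker, hrange⟩) m) hx'
  · exact f.iterateRange.monotone h hx

theorem finiteDimensional_hyperkernel_of_disjoint [FiniteDimensional K (LinearMap.ker f)]
    (h : Disjoint (LinearMap.ker f) (hyperrange f)) : FiniteDimensional K (hyperkernel f) := by
  obtain ⟨n, hn⟩ := exists_ker_inf_range_pow_le_hyperrange f
  have hdisj : LinearMap.ker f ⊓ LinearMap.range (f ^ n) = ⊥ :=
    eq_bot_iff.2 ((le_inf inf_le_left hn).trans h.le_bot)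
  have hstab : LinearMap.ker (f ^ n) = LinearMap.ker (f ^ n.succ) := by
    refine le_antisymm (f.iterateKer.monotone n.le_succ) fun x hx => ?_
    rw [LinearMap.mem_ker, pow_succ'] at hx
    exact (Submodule.mem_bot K).1 (hdisj ▸ ⟨hx, x, rfl⟩)
  have hle : hyperkernel f ≤ LinearMap.ker (f ^ n) := fun x hx => by
    obtain ⟨m, hm⟩ := mem_hyperkernel.1 hx
    rw [Module.End.ker_pow_constant hstab m, LinearMap.mem_ker, pow_add, Module.End.mul_apply, hm,
      map_zero]
  have := finiteDimensional_ker_pow (f := f) n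
  exact Submodule.finiteDimensional_of_le hle

theorem hyperkernel_le_range_of_mul_eq_one_sub {p : Module.End K V} (hcomm : Commute g f)
    (h : g * f = 1 - p) : hyperkernel f ≤ LinearMap.range p := fun x hx => by
  obtain ⟨n, hn⟩ := mem_hyperkernel.1 hx
  have hpow : ((1 - p) ^ n) x = 0 := by
    rw [← h, hcomm.mul_pow, Module.End.mul_apply, hn, map_zero]
  exact ⟨_, smul_geom_sum_smul_eq_of_pow_smul_eq_zero (A := Module.End K V) hpow⟩

theorem cofg_range_of_mul_eq_one_sub {p : Module.End K V} (h : f * g = 1 - p)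
    [FiniteDimensional K (LinearMap.range p)] : (LinearMap.range f).CoFG := by
  refine Module.Finite.of_surjective ((LinearMap.range f).mkQ ∘ₗ (LinearMap.range p).subtype)
    fun y => ?_
  obtain ⟨y, rfl⟩ := Submodule.mkQ_surjective _ y
  have hy : y - p y = f (g y) := (LinearMap.congr_fun h y).symm
  refine ⟨⟨p y, y, rfl⟩, .symm ((Submodule.Quotient.eq _).2 ?_)⟩
  exact ⟨g y, hy.symm⟩

variable {N : Submodule K V} {hN : N ≤ N.comap f}

theorem ker_le_of_injective_mapQ (h : Function.Injective (N.mapQ N f hN)) :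
    LinearMap.ker f ≤ N := fun x hx => by
  rw [← Submodule.Quotient.mk_eq_zero]
  apply h
  rw [Submodule.mapQ_apply, LinearMap.mem_ker.1 hx, map_zero, Submodule.Quotient.mk_zero]

theorem cofg_range_of_surjective_mapQ [FiniteDimensional K N]
    (h : Function.Surjective (N.mapQ N f hN)) : (LinearMap.range f).CoFG := by
  have hsup : N ⊔ LinearMap.range f = ⊤ := by
    rw [← Submodule.map_mkQ_eq_top, ← LinearMap.range_comp, ← Submodule.mapQ_mkQ N N f (h := hN),
      LinearMap.range_comp, Submodule.range_mkQ, Submodule.map_top, LinearMap.range_eq_top.2 h]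
  refine Module.Finite.of_surjective ((LinearMap.range f).mkQ ∘ₗ N.subtype) ?_
  rw [← LinearMap.range_eq_top, LinearMap.range_comp, Submodule.range_subtype,
    Submodule.map_mkQ_eq_top, sup_comm, hsup]

theorem index_eq_zero_of_bijective_mapQ [FiniteDimensional K N]
    (h : Function.Bijective (N.mapQ N f hN)) : f.index = 0 := by
  have := Submodule.finiteDimensional_of_le (ker_le_of_injective_mapQ h.1)
  have := cofg_range_of_surjective_mapQ h.2
  have hker_mkQ : FiniteDimensional K (LinearMap.ker N.mkQ) := by rwa [N.ker_mkQ]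
  have hker : FiniteDimensional K (LinearMap.ker (N.mapQ N f hN)) := by
    rw [LinearMap.ker_eq_bot.2 h.1]; infer_instance
  have hcoker_mkQ : (LinearMap.range N.mkQ).CoFG := by rw [N.range_mkQ]; exact .top
  have hcoker : (LinearMap.range (N.mapQ N f hN)).CoFG := by
    rw [LinearMap.range_eq_top.2 h.2]; exact .top
  have hindex : (N.mapQ N f hN).index = 0 :=
    LinearEquiv.index_eq_zero (e := .ofBijective (N.mapQ N f hN) h)
  have hcomp := congrArg LinearMap.index (Submodule.mapQ_mkQ N N f (h := hN))
  rw [LinearMap.index_comp, LinearMap.index_comp, hindex] at hcomp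
  linarith

end LinearAlgebra

section NormedSpace

variable {𝕜 E F : Type*} [NontriviallyNormedField 𝕜] [NormedAddCommGroup E] [NormedSpace 𝕜 E]
  [NormedAddCommGroup F] [NormedSpace 𝕜 F]

theorem surjective_of_mem_closure_surjective [CompleteSpace E] {A : E →L[𝕜] F} {K : NNReal}
    (hA : AntilipschitzWith K A) (h : A ∈ closure {B : E →L[𝕜] F | Function.Surjective B}) :
    Function.Surjective A := by
  intro y
  suffices hy : y ∈ closure (Set.range A) by
    rwa [(hA.isClosed_range A.uniformContinuous).closure_eq] at hy
  refine Metric.mem_closure_iff.2 fun δ hδ => ?_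
  have tendsto_zero (c : ℝ) : Tendsto (fun B => c * ‖A - B‖) (𝓝 A) (𝓝 0) := by
    have : Continuous fun B => c * ‖A - B‖ := by fun_prop
    simpa using this.tendsto A
  obtain ⟨B, hB, hBK, hBδ⟩ := ((mem_closure_iff_frequently.1 h).and_eventually
    (((tendsto_zero K).eventually_lt_const one_half_pos).and
      ((tendsto_zero (2 * K * ‖y‖)).eventually_lt_const hδ))).exists
  obtain ⟨x, rfl⟩ := hB y
  have hdiff : ‖A x - B x‖ ≤ ‖A - B‖ * ‖x‖ := (A - B).le_opNorm x
  have hx : ‖x‖ ≤ 2 * K * ‖B x‖ := by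
    have : ‖x‖ ≤ K * (‖B x‖ + ‖A - B‖ * ‖x‖) := calc
      ‖x‖ ≤ K * ‖A x‖ := by simpa using hA.le_mul_dist x 0
      _ ≤ K * (‖B x‖ + ‖A - B‖ * ‖x‖) := by
        gcongr
        linarith [norm_sub_norm_le (A x) (B x)]
    nlinarith [norm_nonneg x]
  refine ⟨A x, ⟨x, rfl⟩, ?_⟩
  calc dist (B x) (A x) ≤ ‖A - B‖ * ‖x‖ := by rwa [dist_comm, dist_eq_norm]
    _ ≤ ‖A - B‖ * (2 * K * ‖B x‖) := by gcongr
    _ < δ := by rwa [mul_comm]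

theorem injective_of_mem_closure_injective [CompleteSpace F] {A : E →L[𝕜] F}
    (hA : A.HasRightInverse) (h : A ∈ closure {B : E →L[𝕜] F | Function.Injective B}) :
    Function.Injective A := by
  obtain ⟨J, hJ⟩ := hA
  have hunits : ∀ᶠ B in 𝓝 A, IsUnit (B ∘L J) := by
    have hcont : Continuous fun B : E →L[𝕜] F => B ∘L J := by fun_prop
    refine hcont.continuousAt.eventually (Units.isOpen.mem_nhds ?_)
    have hAJ : A ∘L J = 1 := ContinuousLinearMap.ext hJ
    change IsUnit (A ∘L J)
    rw [hAJ]
    exact isUnit_one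
  obtain ⟨B, hB, hBJ⟩ := ((mem_closure_iff_frequently.1 h).and_eventually hunits).exists
  have hJsurj : Function.Surjective J := fun x => by
    obtain ⟨u, hu⟩ := hBJ
    refine ⟨u⁻¹.val (B x), hB ?_⟩
    rw [← ContinuousLinearMap.comp_apply, ← hu, ← mul_apply_eq_comp, u.mul_inv]
    rfl
  exact (hJ.rightInverse_of_surjective hJsurj).injective

/-- The bounded operator induced on the quotient by an invariant subspace. -/
def mapQL (N : Submodule 𝕜 E) (A : E →L[𝕜] E) (hA : N ≤ N.comap A.toLinearMap) :
    E ⧸ N →L[𝕜] E ⧸ N :=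
  N.liftQL (N.mkQL ∘L A) fun _ hx => (Submodule.Quotient.mk_eq_zero N).2 (hA hx)

section mapQL

variable {N : Submodule 𝕜 E} {A B : E →L[𝕜] E} (hA : N ≤ N.comap A.toLinearMap)
  (hB : N ≤ N.comap B.toLinearMap)

theorem norm_mapQL_le : ‖mapQL N A hA‖ ≤ ‖A‖ := by
  refine ContinuousLinearMap.opNorm_le_bound _ (norm_nonneg _) fun x => ?_
  refine le_mul_of_forall_lt₀ fun a ha b hb => ?_
  obtain ⟨m, rfl, hm⟩ := (QuotientAddGroup.norm_lt_iff (S := N.toAddSubgroup)).1 hb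
  calc ‖N.mkQ (A m)‖ ≤ ‖A m‖ := Submodule.Quotient.norm_mk_le N (A m)
    _ ≤ a * b := A.le_of_opNorm_le_of_le ha.le hm.le

theorem mapQL_sub_mapQL (hAB : N ≤ N.comap (A - B).toLinearMap) :
    mapQL N A hA - mapQL N B hB = mapQL N (A - B) hAB := by
  ext x
  obtain ⟨x, rfl⟩ := N.mkQ_surjective x
  exact (map_sub N.mkQ (A x) (B x)).symm

end mapQL

theorem mapQL_mem_closure_surjective {N : Submodule 𝕜 E} {S : E →L[𝕜] E}
    (hS : N ≤ N.comap S.toLinearMap)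
    (h : S ∈ closure {B : E →L[𝕜] E | N ≤ N.comap B.toLinearMap ∧ Function.Surjective B}) :
    mapQL N S hS ∈ closure {B : E ⧸ N →L[𝕜] E ⧸ N | Function.Surjective B} := by
  refine Metric.mem_closure_iff.2 fun ε hε => ?_
  obtain ⟨B, ⟨hB, hsurj⟩, hSB⟩ := Metric.mem_closure_iff.1 h ε hε
  refine ⟨mapQL N B hB, .of_comp (g := N.mkQ) (N.mkQ_surjective.comp hsurj), ?_⟩
  rw [dist_eq_norm] at hSB ⊢
  rw [mapQL_sub_mapQL hS hB fun x hx => N.sub_mem (hS hx) (hB hx)]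
  exact (norm_mapQL_le _).trans_lt hSB

theorem restrict_mem_closure_injective {Y : Submodule 𝕜 E} {S : E →L[𝕜] E}
    (hS : ∀ x ∈ Y, S x ∈ Y)
    (h : S ∈ closure {B : E →L[𝕜] E | (∀ x ∈ Y, B x ∈ Y) ∧ Function.Injective B}) :
    S.restrict hS ∈ closure {B : Y →L[𝕜] Y | Function.Injective B} := by
  refine Metric.mem_closure_iff.2 fun ε hε => ?_
  obtain ⟨B, ⟨hB, hinj⟩, hSB⟩ := Metric.mem_closure_iff.1 h ε hε
  refine ⟨B.restrict hB, fun x y hxy => Subtype.ext (hinj (congrArg Subtype.val hxy)), ?_⟩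
  refine lt_of_le_of_lt ?_ hSB
  rw [dist_eq_norm, dist_eq_norm]
  exact ContinuousLinearMap.opNorm_le_bound _ (norm_nonneg _) fun x => (S - B).le_opNorm x

theorem hasRightInverse_of_surjective [CompleteSpace E] [CompleteSpace F] {A : E →L[𝕜] F}
    (hA : Function.Surjective A) (hker : A.ker.ClosedComplemented) : A.HasRightInverse := by
  obtain ⟨p, hp⟩ := hker
  have : CompleteSpace A.ker := A.isClosed_ker.completeSpace_coe
  let e := A.equivProdOfSurjectiveOfIsCompl p (LinearMap.range_eq_top.2 hA)
    (LinearMap.range_eq_of_proj hp) (LinearMap.isCompl_of_proj hp)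
  refine ⟨e.symm ∘L ContinuousLinearMap.inl 𝕜 F A.ker, fun y => ?_⟩
  exact congrArg Prod.fst (e.apply_symm_apply (y, 0))

theorem commute_toLinearMap {S B : E →L[𝕜] E} (h : Commute S B) :
    Commute S.toLinearMap B.toLinearMap :=
  h.map ContinuousLinearMap.toLinearMapRingHom

theorem map_mem_hyperrange_of_commute {S B : E →L[𝕜] E} (h : Commute S B) :
    ∀ x ∈ hyperrange S.toLinearMap, B x ∈ hyperrange S.toLinearMap :=
  fun _ => map_mem_hyperrange (commute_toLinearMap h)

theorem hyperkernel_le_comap {S B : E →L[𝕜] E} (h : Commute S B) :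
    hyperkernel S.toLinearMap ≤ (hyperkernel S.toLinearMap).comap B.toLinearMap :=
  fun _ => map_mem_hyperkernel (commute_toLinearMap h)

theorem isUnit_mapQL_hyperkernel_of_commute {S A : E →L[𝕜] E} (h : Commute S A)
    (hA : IsUnit A) : IsUnit (mapQL _ A (hyperkernel_le_comap h)) := by
  obtain ⟨u, rfl⟩ := hA
  set N := hyperkernel S.toLinearMap
  refine isUnit_iff_exists.2 ⟨mapQL N ↑u⁻¹ (hyperkernel_le_comap h.units_inv_right), ?_, ?_⟩ <;>
    ext x <;> obtain ⟨x, rfl⟩ := N.mkQ_surjective x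
  · exact congrArg N.mkQ (DFunLike.congr_fun u.mul_inv x)
  · exact congrArg N.mkQ (DFunLike.congr_fun u.inv_mul x)

variable [CompleteSpace 𝕜] [CompleteSpace E]

theorem isClosed_range_of_cofg [CompleteSpace F] {A : E →L[𝕜] F} (hA : A.range.CoFG) :
    IsClosed (A.range : Set F) := by
  obtain ⟨G, hG⟩ := A.range.exists_isCompl
  have : FiniteDimensional 𝕜 G := .of_fg (hA.fg_of_isCompl hG)
  have : IsClosed (A.ker : Set E) := A.isClosed_ker
  have hrange : (A.ker.liftQL A le_rfl).range = A.range := by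
    rw [Submodule.toLinearMap_liftQL, Submodule.range_liftQ]
  rw [← hrange]
  refine ContinuousLinearMap.closed_complemented_range_of_isCompl_of_ker_eq_bot _ G (hrange ▸ hG)
    G.closed_of_finiteDimensional ?_
  rw [Submodule.toLinearMap_liftQL]
  exact Submodule.ker_liftQ_eq_bot _ _ _ le_rfl

theorem isClosed_hyperrange {S : E →L[𝕜] E} (hS : S.range.CoFG) :
    IsClosed (hyperrange S.toLinearMap : Set E) := by
  rw [hyperrange, Submodule.coe_iInf]
  refine isClosed_iInter fun n => ?_
  have hpow := cofg_range_pow hS n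
  rw [← ContinuousLinearMap.toLinearMap_pow] at hpow ⊢
  exact isClosed_range_of_cofg hpow

theorem isUnit_mapQL_hyperkernel {S : E →L[𝕜] E} (hS : IsClosed (S.range : Set E))
    [FiniteDimensional 𝕜 (hyperkernel S.toLinearMap)]
    (h : S ∈ closure {B : E →L[𝕜] E | Commute S B ∧ Function.Surjective B}) :
    IsUnit (mapQL _ S (hyperkernel_le_comap (Commute.refl S))) := by
  set N := hyperkernel S.toLinearMap
  have hN : IsClosed (N : Set E) := N.closed_of_finiteDimensional
  set S' := mapQL N S (hyperkernel_le_comap (Commute.refl S))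
  have hinj : Function.Injective S' := by
    refine (injective_iff_map_eq_zero S').2 fun x hx => ?_
    obtain ⟨x, rfl⟩ := N.mkQ_surjective x
    exact (Submodule.Quotient.mk_eq_zero N).2
      (map_mem_hyperkernel_iff.1 ((Submodule.Quotient.mk_eq_zero N).1 hx))
  have hclosed : IsClosed (S'.range : Set (E ⧸ N)) := by
    have hrange : S'.range.comap N.mkQ = N ⊔ S.range := by
      rw [← Submodule.comap_map_mkQ, ← LinearMap.range_comp,
        ← LinearMap.range_comp_of_range_eq_top _ N.range_mkQ]
      rfl
    rw [← N.isQuotientMap_mkQL.isClosed_preimage]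
    change IsClosed (S'.range.comap N.mkQ : Set E)
    rw [hrange, sup_comm]
    exact Submodule.isClosed_sup_finiteDimensional S.range N hS
  have hcommute : {B : E →L[𝕜] E | Commute S B ∧ Function.Surjective B} ⊆
      {B | N ≤ N.comap B.toLinearMap ∧ Function.Surjective B} :=
    fun B hB => ⟨hyperkernel_le_comap hB.1, hB.2⟩
  obtain ⟨K, hK⟩ := S'.antilipschitz_of_injective_of_isClosed_range hinj hclosed
  exact ContinuousLinearMap.isUnit_iff_bijective.2 ⟨hinj, surjective_of_mem_closure_surjective hK
    (mapQL_mem_closure_surjective _ (closure_mono hcommute h))⟩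

end NormedSpace

section RCLike

variable {𝕜 E : Type*} [RCLike 𝕜] [NormedAddCommGroup E] [NormedSpace 𝕜 E] [CompleteSpace E]

theorem disjoint_ker_hyperrange {S : E →L[𝕜] E} [FiniteDimensional 𝕜 S.ker] (hS : S.range.CoFG)
    (h : S ∈ closure {B : E →L[𝕜] E | Commute S B ∧ Function.Injective B}) :
    Disjoint S.ker (hyperrange S.toLinearMap) := by
  set Y := hyperrange S.toLinearMap
  have : CompleteSpace Y := (isClosed_hyperrange hS).completeSpace_coe
  set S' := S.restrict (map_mem_hyperrange_of_commute (Commute.refl S))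
  have hsurj : Function.Surjective S' := fun y => by
    obtain ⟨x, hx, hxy⟩ := surjOn_hyperrange S.toLinearMap y.2
    exact ⟨⟨x, hx⟩, Subtype.ext hxy⟩
  have hker : FiniteDimensional 𝕜 S'.ker :=
    .of_injective ((Y.subtype ∘ₗ S'.ker.subtype).codRestrict S.ker
      fun x => congrArg Subtype.val x.2) fun x y hxy =>
        Subtype.ext (Subtype.ext (congrArg Subtype.val hxy :))
  have hcommute : {B : E →L[𝕜] E | Commute S B ∧ Function.Injective B} ⊆
      {B | (∀ x ∈ Y, B x ∈ Y) ∧ Function.Injective B} :=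
    fun B hB => ⟨map_mem_hyperrange_of_commute hB.1, hB.2⟩
  have hinj : Function.Injective S' := injective_of_mem_closure_injective
    (hasRightInverse_of_surjective hsurj (.of_finiteDimensional _))
    (restrict_mem_closure_injective _ (closure_mono hcommute h))
  rw [Submodule.disjoint_def]
  intro x hx hxY
  have hx0 : S' ⟨x, hxY⟩ = S' 0 := Subtype.ext ((LinearMap.mem_ker.1 hx).trans (map_zero S).symm)
  exact congrArg Subtype.val (hinj hx0)

theorem finiteDimensional_hyperkernel {S : E →L[𝕜] E} [FiniteDimensional 𝕜 S.ker]
    (hS : S.range.CoFG)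
    (h : S ∈ closure {B : E →L[𝕜] E | Commute S B ∧ Function.Injective B}) :
    FiniteDimensional 𝕜 (hyperkernel S.toLinearMap) :=
  finiteDimensional_hyperkernel_of_disjoint (disjoint_ker_hyperrange hS h)

end RCLike

section Resolvent

variable {X : Type*} [NormedAddCommGroup X] [NormedSpace ℂ X]

/-- The family `1 - (z - w) R` of bounded operators, which is `(T - z) (T - w)⁻¹` when
`R = (T - w)⁻¹`. -/
def pencil (R : X →L[ℂ] X) (w z : ℂ) : X →L[ℂ] X := 1 - (z - w) • R

section pencil

variable (R : X →L[ℂ] X) (w z : ℂ)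

theorem pencil_apply (x : X) : pencil R w z x = x - (z - w) • R x := rfl

theorem commute_pencil : Commute (pencil R w z) R :=
  (Commute.one_left R).sub_left ((Commute.refl R).smul_left _)

theorem commute_pencil_pencil (ζ : ℂ) : Commute (pencil R w z) (pencil R w ζ) :=
  (Commute.one_right _).sub_right ((commute_pencil R w z).smul_right _)

theorem differentiable_pencil : Differentiable ℂ (pencil R w) := by
  unfold pencil
  fun_prop

theorem differentiableAt_inverse_pencil [CompleteSpace X] {R : X →L[ℂ] X} {w z : ℂ}
    (hz : IsUnit (pencil R w z)) : DifferentiableAt ℂ (fun ζ => Ring.inverse (pencil R w ζ)) z :=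
  (differentiable_pencil R w z).inverse hz

variable {R w z}

theorem pencil_mem_closure_isUnit (h : ∀ᶠ ζ in 𝓝[≠] z, IsUnit (pencil R w ζ)) :
    pencil R w z ∈ closure {B | Commute (pencil R w z) B ∧ IsUnit B} :=
  mem_closure_of_tendsto
    (((differentiable_pencil R w).continuous.tendsto z).mono_left nhdsWithin_le_nhds)
    (h.mono fun ζ hζ => ⟨commute_pencil_pencil R w z ζ, hζ⟩)

theorem exists_eq_apply_of_pencil_pow_apply_eq_zero {n : ℕ} {x : X}
    (hx : (pencil R w z ^ n) x = 0) : ∃ y, R y = x ∧ (pencil R w z ^ n) y = 0 := by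
  set A := pencil R w z
  set G := ∑ i ∈ Finset.range n, A ^ i
  have hcomm : Commute (A ^ n) G := .sum_right _ _ _ fun i _ => Commute.pow_pow_self A n i
  refine ⟨(z - w) • G x, ?_, ?_⟩
  · calc R ((z - w) • G x) = ((z - w) • R) (G x) := map_smul R _ _
      _ = x := smul_geom_sum_smul_eq_of_pow_smul_eq_zero (A := X →L[ℂ] X) hx
  · calc (A ^ n) ((z - w) • G x) = (z - w) • (A ^ n * G) x := map_smul (A ^ n) _ _
      _ = 0 := by rw [hcomm.eq, mul_apply_eq_comp, hx, map_zero, smul_zero]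

end pencil

variable {T : X →ₗ.[ℂ] X} {w : ℂ} {R : X →L[ℂ] X}

theorem IsBoundedInverse.resolventOp_eq (h : IsBoundedInverse T w R) : resolventOp T w = R := by
  have hex : ∃ R : X →L[ℂ] X, IsBoundedInverse T w R := ⟨R, h⟩
  rw [resolventOp, dif_pos hex]
  ext x
  obtain ⟨hx, hRx⟩ := h.1 x
  conv_lhs => rw [← hRx]
  exact hex.choose_spec.2 _

/-- The inverse of `T - w`, as a linear equivalence onto the domain of `T`. -/
def IsBoundedInverse.equivDomain (h : IsBoundedInverse T w R) : X ≃ₗ[ℂ] T.domain :=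
  .ofLinearMap (R.toLinearMap.codRestrict T.domain fun x => (h.1 x).1) (shift T w)
    (LinearMap.ext fun x => Subtype.ext (h.2 x)) (LinearMap.ext fun x => (h.1 x).2)

namespace IsBoundedInverse

theorem coe_equivDomain_apply (h : IsBoundedInverse T w R) (x : X) :
    (h.equivDomain x : X) = R x := rfl

theorem shift_equivDomain_apply (h : IsBoundedInverse T w R) (z : ℂ) (x : X) :
    shift T z (h.equivDomain x) = pencil R w z x := by
  have hx : shift T w (h.equivDomain x) = x := h.equivDomain.symm_apply_apply x
  have hshift (d : T.domain) : shift T z d = shift T w d - (z - w) • (d : X) := by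
    simp only [shift, LinearMap.sub_apply, LinearMap.smul_apply, Submodule.subtype_apply]
    module
  rw [hshift, hx, coe_equivDomain_apply, pencil_apply]

theorem shift_comp_equivDomain (h : IsBoundedInverse T w R) (z : ℂ) :
    shift T z ∘ₗ h.equivDomain.toLinearMap = (pencil R w z).toLinearMap :=
  LinearMap.ext (h.shift_equivDomain_apply z)

theorem ran_eq_range (h : IsBoundedInverse T w R) (z : ℂ) : ran T z = (pencil R w z).range := by
  rw [← h.shift_comp_equivDomain, LinearEquiv.range_comp, ran]

/-- `(T - w)⁻¹` identifies the kernel of `(T - z) (T - w)⁻¹` with that of `T - z`. -/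
def kerEquiv (h : IsBoundedInverse T w R) (z : ℂ) :
    (pencil R w z).ker ≃ₗ[ℂ] LinearMap.ker (shift T z) :=
  h.equivDomain.ofSubmodules _ _ <| by
    rw [← h.shift_comp_equivDomain, LinearMap.ker_comp]
    exact Submodule.map_comap_eq_of_surjective h.equivDomain.surjective _

theorem indexAt_eq_index (h : IsBoundedInverse T w R) (z : ℂ) :
    indexAt T z = (pencil R w z).toLinearMap.index := by
  rw [indexAt, h.ran_eq_range, ← (h.kerEquiv z).finrank_eq]
  rfl

theorem isFredholmAt_iff [CompleteSpace X] (h : IsBoundedInverse T w R) (z : ℂ) :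
    IsFredholmAt T z ↔ FiniteDimensional ℂ (pencil R w z).ker ∧ (pencil R w z).range.CoFG := by
  have hker : FiniteDimensional ℂ (pencil R w z).ker ↔
      FiniteDimensional ℂ (LinearMap.ker (shift T z)) := Module.Finite.equiv_iff (h.kerEquiv z)
  rw [IsFredholmAt, h.ran_eq_range, ← hker]
  exact ⟨fun hF => hF.2, fun hF => ⟨isClosed_range_of_cofg hF.2, hF⟩⟩

theorem mul_inverse (h : IsBoundedInverse T w R) {z : ℂ} (hz : IsUnit (pencil R w z)) :
    IsBoundedInverse T z (R * Ring.inverse (pencil R w z)) := by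
  refine ⟨fun x => ⟨(h.1 _).1, ?_⟩, fun d => ?_⟩
  · calc shift T z (h.equivDomain (Ring.inverse (pencil R w z) x))
        = (pencil R w z * Ring.inverse (pencil R w z)) x := h.shift_equivDomain_apply z _
      _ = x := by rw [Ring.mul_inverse_cancel _ hz]; rfl
  · obtain ⟨x, rfl⟩ := h.equivDomain.surjective d
    calc R (Ring.inverse (pencil R w z) (shift T z (h.equivDomain x)))
        = R ((Ring.inverse (pencil R w z) * pencil R w z) x) := by
          rw [h.shift_equivDomain_apply]; rfl
      _ = R x := by rw [Ring.inverse_mul_cancel _ hz]; rfl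

variable [CompleteSpace X]

theorem mem_rho_iff (h : IsBoundedInverse T w R) {z : ℂ} :
    z ∈ rho T ↔ IsUnit (pencil R w z) := by
  refine ⟨fun ⟨R', h'⟩ => ?_, fun hz => ⟨_, h.mul_inverse hz⟩⟩
  rw [ContinuousLinearMap.isUnit_iff_bijective]
  have hshift : Function.Bijective (shift T z) := h'.equivDomain.symm.bijective
  convert hshift.comp h.equivDomain.bijective
  exact funext fun x => (h.shift_equivDomain_apply z x).symm

theorem resolventOp_eq_mul_inverse (h : IsBoundedInverse T w R) {z : ℂ} (hz : z ∈ rho T) :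
    resolventOp T z = R * Ring.inverse (pencil R w z) :=
  (h.mul_inverse (h.mem_rho_iff.1 hz)).resolventOp_eq

end IsBoundedInverse

theorem isOpen_rho [CompleteSpace X] (T : X →ₗ.[ℂ] X) : IsOpen (rho T) := by
  rcases (rho T).eq_empty_or_nonempty with hrho | ⟨w, R, h⟩
  · rw [hrho]
    exact isOpen_empty
  · rw [show rho T = pencil R w ⁻¹' {A | IsUnit A} from Set.ext fun z => h.mem_rho_iff]
    exact Units.isOpen.preimage (differentiable_pencil R w).continuous

theorem continuousOn_resolventOp [CompleteSpace X] (T : X →ₗ.[ℂ] X) :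
    ContinuousOn (resolventOp T) (rho T) := fun w ⟨R, h⟩ => by
  have hcont : ContinuousOn (fun z => R * Ring.inverse (pencil R w z)) (rho T) := fun z hz =>
    ((differentiableAt_inverse_pencil (h.mem_rho_iff.1 hz)).const_mul R
      ).continuousAt.continuousWithinAt
  exact hcont.congr (fun z => h.resolventOp_eq_mul_inverse) w ⟨R, h⟩

theorem IsBoundedInverse.kerPow_eq_ker_pow (h : IsBoundedInverse T w R) (z : ℂ) (n : ℕ) :
    kerPow T z n = (pencil R w z ^ n).ker := by
  induction n with
  | zero => rw [pow_zero]; exact LinearMap.ker_id.symm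
  | succ n ih =>
    have hshift (y : X) : (pencil R w z ^ n) (shift T z (h.equivDomain y)) =
        (pencil R w z ^ (n + 1)) y := by
      rw [h.shift_equivDomain_apply, pow_succ]; rfl
    rw [kerPow, ih]
    ext x
    constructor
    · rintro ⟨d, hd, rfl⟩
      obtain ⟨y, rfl⟩ := h.equivDomain.surjective d
      calc (pencil R w z ^ (n + 1)) (R y) = R ((pencil R w z ^ (n + 1)) y) :=
            DFunLike.congr_fun ((commute_pencil R w z).pow_left (n + 1)).eq y
        _ = R ((pencil R w z ^ n) (shift T z (h.equivDomain y))) := by rw [hshift]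
        _ = 0 := (congrArg R hd).trans (map_zero R)
    · intro hx
      obtain ⟨y, rfl, hy⟩ := exists_eq_apply_of_pencil_pow_apply_eq_zero (n := n + 1) hx
      exact ⟨h.equivDomain y, (hshift y).trans hy, rfl⟩

theorem IsBoundedInverse.genKer_eq_hyperkernel (h : IsBoundedInverse T w R) (z : ℂ) :
    genKer T z = hyperkernel (pencil R w z).toLinearMap := by
  have hkerPow : kerPow T z = fun n => LinearMap.ker ((pencil R w z).toLinearMap ^ n) :=
    funext fun n => by rw [h.kerPow_eq_ker_pow, ContinuousLinearMap.toLinearMap_pow]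
  have hmono : Monotone fun n => LinearMap.ker ((pencil R w z).toLinearMap ^ n) :=
    (pencil R w z).toLinearMap.iterateKer.monotone
  ext x
  rw [genKer, hkerPow, Submodule.mem_iSup_of_directed _ hmono.directed_le, mem_hyperkernel]
  rfl

end Resolvent

section RieszProjection

theorem map_circleIntegral {E F : Type*} [NormedAddCommGroup E] [NormedSpace ℂ E] [CompleteSpace E]
    [NormedAddCommGroup F] [NormedSpace ℂ F] [CompleteSpace F] (L : E →L[ℂ] F) {f : ℂ → E} {c : ℂ}
    {r : ℝ} (hf : CircleIntegrable f c r) :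
    L (∮ z in C(c, r), f z) = ∮ z in C(c, r), L (f z) := by
  simp only [circleIntegral, ← map_smul]
  exact (L.intervalIntegral_comp_comm hf.out).symm

theorem commute_circleIntegral {A : Type*} [NormedRing A] [NormedAlgebra ℂ A] [CompleteSpace A]
    {a : A} {f : ℂ → A} {c : ℂ} {r : ℝ} (hr : 0 ≤ r) (hf : CircleIntegrable f c r)
    (ha : ∀ z ∈ Metric.sphere c r, Commute a (f z)) : Commute a (∮ z in C(c, r), f z) := calc
  a * (∮ z in C(c, r), f z) = ∮ z in C(c, r), a * f z :=
    map_circleIntegral (ContinuousLinearMap.mul ℂ A a) hf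
  _ = ∮ z in C(c, r), f z * a := circleIntegral.integral_congr hr fun z hz => (ha z hz).eq
  _ = (∮ z in C(c, r), f z) * a :=
    (map_circleIntegral ((ContinuousLinearMap.mul ℂ A).flip a) hf).symm

theorem comp_inverse_eq_inverse_comp {𝕜 E F : Type*} [NontriviallyNormedField 𝕜]
    [NormedAddCommGroup E] [NormedSpace 𝕜 E] [NormedAddCommGroup F] [NormedSpace 𝕜 F]
    {φ : E →L[𝕜] F} {A : E →L[𝕜] E} {B : F →L[𝕜] F} (h : φ ∘L A = B ∘L φ) (hA : IsUnit A)
    (hB : IsUnit B) : φ ∘L Ring.inverse A = Ring.inverse B ∘L φ := calc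
  φ ∘L Ring.inverse A = (Ring.inverse B * B) ∘L φ ∘L Ring.inverse A := by
    rw [Ring.inverse_mul_cancel _ hB]; rfl
  _ = Ring.inverse B ∘L (φ ∘L A) ∘L Ring.inverse A := by rw [h]; rfl
  _ = Ring.inverse B ∘L φ ∘L (A * Ring.inverse A) := rfl
  _ = Ring.inverse B ∘L φ := by rw [Ring.mul_inverse_cancel _ hA]; rfl

variable {X : Type*} [NormedAddCommGroup X] [NormedSpace ℂ X] {T : X →ₗ.[ℂ] X} {w z : ℂ}
  {R : X →L[ℂ] X} {r : ℝ}

/-- The integral `(2πi)⁻¹ ∮ (ζ - z)⁻¹ (T - ζ)⁻¹ dζ` over `|ζ - z| = r`, which is the constant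
coefficient of the Laurent expansion of the resolvent at an isolated point `z` of the spectrum. -/
noncomputable def reducedResolvent (T : X →ₗ.[ℂ] X) (z : ℂ) (r : ℝ) : X →L[ℂ] X :=
  (2 * Real.pi * Complex.I : ℂ)⁻¹ • ∮ ζ in C(z, r), (ζ - z)⁻¹ • resolventOp T ζ

theorem sphere_subset_rho (hr : 0 < r) (hz : Metric.closedBall z r \ {z} ⊆ rho T) :
    Metric.sphere z r ⊆ rho T := fun _ hζ =>
  hz ⟨Metric.sphere_subset_closedBall hζ, Metric.ne_of_mem_sphere hζ hr.ne'⟩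

variable [CompleteSpace X]

theorem circleIntegrable_resolventOp (hr : 0 < r) (hz : Metric.closedBall z r \ {z} ⊆ rho T) :
    CircleIntegrable (resolventOp T) z r :=
  ((continuousOn_resolventOp T).mono (sphere_subset_rho hr hz)).circleIntegrable hr.le

theorem circleIntegrable_inv_smul_resolventOp (hr : 0 < r)
    (hz : Metric.closedBall z r \ {z} ⊆ rho T) :
    CircleIntegrable (fun ζ => (ζ - z)⁻¹ • resolventOp T ζ) z r := by
  refine ContinuousOn.circleIntegrable hr.le (ContinuousOn.fun_smul ?_
    ((continuousOn_resolventOp T).mono (sphere_subset_rho hr hz)))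
  exact (continuousOn_id.sub continuousOn_const).inv₀ fun ζ hζ =>
    sub_ne_zero.2 (Metric.ne_of_mem_sphere hζ hr.ne')

namespace IsBoundedInverse

theorem comp_rieszProjection_eq_zero {Y : Type*} [NormedAddCommGroup Y] [NormedSpace ℂ Y]
    [CompleteSpace Y] {φ : X →L[ℂ] Y} {R' : Y →L[ℂ] Y} (h : IsBoundedInverse T w R)
    (hr : 0 < r) (hz : Metric.closedBall z r \ {z} ⊆ rho T) (hφ : φ ∘L R = R' ∘L φ)
    (hunit : ∀ ζ ∈ Metric.closedBall z r, IsUnit (pencil R' w ζ)) :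
    φ ∘L rieszProjection T z r = 0 := by
  have hpencil (ζ : ℂ) : φ ∘L pencil R w ζ = pencil R' w ζ ∘L φ := by
    ext x
    have hx : φ (R x) = R' (φ x) := DFunLike.congr_fun hφ x
    simp only [ContinuousLinearMap.comp_apply, pencil_apply, map_sub, map_smul, hx]
  have hsphere : ∀ ζ ∈ Metric.sphere z r,
      φ ∘L resolventOp T ζ = (R' * Ring.inverse (pencil R' w ζ)) ∘L φ := fun ζ hζ => by
    have hζ' := sphere_subset_rho hr hz hζ
    calc φ ∘L resolventOp T ζ = (φ ∘L R) ∘L Ring.inverse (pencil R w ζ) := by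
          rw [h.resolventOp_eq_mul_inverse hζ']; rfl
      _ = R' ∘L (φ ∘L Ring.inverse (pencil R w ζ)) := by rw [hφ]; rfl
      _ = (R' * Ring.inverse (pencil R' w ζ)) ∘L φ := by
          rw [comp_inverse_eq_inverse_comp (hpencil ζ) (h.mem_rho_iff.1 hζ')
            (hunit ζ (Metric.sphere_subset_closedBall hζ))]; rfl
  have hdiff : ∀ ζ ∈ Metric.closedBall z r, DifferentiableAt ℂ
      (fun ζ => (R' * Ring.inverse (pencil R' w ζ)) ∘L φ) ζ := fun ζ hζ =>
    ((differentiableAt_inverse_pencil (hunit ζ hζ)).const_mul R').clm_comp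
      (differentiableAt_const φ)
  have hintegral : φ ∘L (∮ ζ in C(z, r), resolventOp T ζ) = 0 := calc
    φ ∘L (∮ ζ in C(z, r), resolventOp T ζ) = ∮ ζ in C(z, r), φ ∘L resolventOp T ζ :=
      map_circleIntegral (ContinuousLinearMap.compL ℂ X X Y φ) (circleIntegrable_resolventOp hr hz)
    _ = ∮ ζ in C(z, r), (R' * Ring.inverse (pencil R' w ζ)) ∘L φ :=
      circleIntegral.integral_congr hr.le hsphere
    _ = 0 := Complex.circleIntegral_eq_zero_of_differentiable_on_off_countable hr.le
      Set.countable_empty (fun ζ hζ => (hdiff ζ hζ).continuousAt.continuousWithinAt)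
      fun ζ hζ => hdiff ζ (Metric.ball_subset_closedBall hζ.1)
  rw [rieszProjection, ContinuousLinearMap.comp_neg, ContinuousLinearMap.comp_smul, hintegral,
    smul_zero, neg_zero]

theorem range_rieszProjection_le_hyperkernel (h : IsBoundedInverse T w R) (hr : 0 < r)
    (hz : Metric.closedBall z r \ {z} ⊆ rho T)
    (hclosed : IsClosed (hyperkernel (pencil R w z).toLinearMap : Set X))
    (hunit : IsUnit (mapQL _ (pencil R w z) (hyperkernel_le_comap (Commute.refl _)))) :
    (rieszProjection T z r).range ≤ hyperkernel (pencil R w z).toLinearMap := by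
  set N := hyperkernel (pencil R w z).toLinearMap
  have hcomm (ζ : ℂ) := commute_pencil_pencil R w z ζ
  have hR : N ≤ N.comap R.toLinearMap := hyperkernel_le_comap (commute_pencil R w z)
  have hmapQL (ζ : ℂ) : pencil (mapQL N R hR) w ζ =
      mapQL N (pencil R w ζ) (hyperkernel_le_comap (hcomm ζ)) := by
    ext x
    obtain ⟨x, rfl⟩ := N.mkQ_surjective x
    rfl
  have hzero : N.mkQL ∘L rieszProjection T z r = 0 := by
    refine h.comp_rieszProjection_eq_zero (R' := mapQL N R hR) hr hz rfl fun ζ hζ => ?_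
    rw [hmapQL]
    rcases eq_or_ne ζ z with rfl | hne
    · exact hunit
    · exact isUnit_mapQL_hyperkernel_of_commute (hcomm ζ) (h.mem_rho_iff.1 (hz ⟨hζ, hne⟩))
  rintro _ ⟨x, rfl⟩
  exact (Submodule.Quotient.mk_eq_zero N).1 (DFunLike.congr_fun hzero x)

theorem pencil_mul_resolventOp (h : IsBoundedInverse T w R) (z : ℂ) {ζ : ℂ} (hζ : ζ ∈ rho T) :
    pencil R w z * resolventOp T ζ = R + (ζ - z) • (R * resolventOp T ζ) := by
  have hself : pencil R w ζ * resolventOp T ζ = R := by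
    rw [h.resolventOp_eq_mul_inverse hζ, ← mul_assoc, (commute_pencil R w ζ).eq, mul_assoc,
      Ring.mul_inverse_cancel _ (h.mem_rho_iff.1 hζ), mul_one]
  have hpencil : pencil R w z = pencil R w ζ + (ζ - z) • R := by
    simp only [pencil]
    module
  rw [hpencil, add_mul, hself, smul_mul_assoc]

theorem commute_pencil_resolventOp (h : IsBoundedInverse T w R) (z : ℂ) {ζ : ℂ}
    (hζ : ζ ∈ rho T) : Commute (pencil R w z) (resolventOp T ζ) := by
  rw [h.resolventOp_eq_mul_inverse hζ]
  have hinv : pencil R w z ∘L Ring.inverse (pencil R w ζ) =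
      Ring.inverse (pencil R w ζ) ∘L pencil R w z :=
    comp_inverse_eq_inverse_comp (commute_pencil_pencil R w z ζ).eq (h.mem_rho_iff.1 hζ)
      (h.mem_rho_iff.1 hζ)
  exact (commute_pencil R w z).mul_right hinv

theorem commute_pencil_rieszProjection (h : IsBoundedInverse T w R) (hr : 0 < r)
    (hz : Metric.closedBall z r \ {z} ⊆ rho T) :
    Commute (pencil R w z) (rieszProjection T z r) :=
  ((commute_circleIntegral hr.le (circleIntegrable_resolventOp hr hz) fun _ hζ =>
    h.commute_pencil_resolventOp z (sphere_subset_rho hr hz hζ)).smul_right _).neg_right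

theorem commute_pencil_reducedResolvent (h : IsBoundedInverse T w R) (hr : 0 < r)
    (hz : Metric.closedBall z r \ {z} ⊆ rho T) :
    Commute (pencil R w z) (reducedResolvent T z r) :=
  (commute_circleIntegral hr.le (circleIntegrable_inv_smul_resolventOp hr hz) fun _ hζ =>
    (h.commute_pencil_resolventOp z (sphere_subset_rho hr hz hζ)).smul_right _).smul_right _

theorem pencil_mul_reducedResolvent (h : IsBoundedInverse T w R) (hr : 0 < r)
    (hz : Metric.closedBall z r \ {z} ⊆ rho T) :
    pencil R w z * reducedResolvent T z r = R - R * rieszProjection T z r := by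
  have hne : ∀ ζ ∈ Metric.sphere z r, ζ - z ≠ 0 := fun ζ hζ =>
    sub_ne_zero.2 (Metric.ne_of_mem_sphere hζ hr.ne')
  have hint₁ : CircleIntegrable (fun ζ => (ζ - z)⁻¹ • R) z r :=
    (((continuousOn_id.sub continuousOn_const).inv₀ hne).fun_smul continuousOn_const
      ).circleIntegrable hr.le
  have hint₂ : CircleIntegrable (fun ζ => R * resolventOp T ζ) z r :=
    (continuousOn_const.mul ((continuousOn_resolventOp T).mono (sphere_subset_rho hr hz))
      ).circleIntegrable hr.le
  have hintegrand : ∀ ζ ∈ Metric.sphere z r, pencil R w z * ((ζ - z)⁻¹ • resolventOp T ζ) =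
      (ζ - z)⁻¹ • R + R * resolventOp T ζ := fun ζ hζ => by
    rw [mul_smul_comm, h.pencil_mul_resolventOp z (sphere_subset_rho hr hz hζ), smul_add,
      inv_smul_smul₀ (hne ζ hζ)]
  have hintegral : pencil R w z * (∮ ζ in C(z, r), (ζ - z)⁻¹ • resolventOp T ζ) =
      (2 * Real.pi * Complex.I : ℂ) • R + R * ∮ ζ in C(z, r), resolventOp T ζ := calc
    _ = ∮ ζ in C(z, r), pencil R w z * ((ζ - z)⁻¹ • resolventOp T ζ) :=
      map_circleIntegral (ContinuousLinearMap.mul ℂ (X →L[ℂ] X) (pencil R w z))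
        (circleIntegrable_inv_smul_resolventOp hr hz)
    _ = ∮ ζ in C(z, r), ((ζ - z)⁻¹ • R + R * resolventOp T ζ) :=
      circleIntegral.integral_congr hr.le hintegrand
    _ = (∮ ζ in C(z, r), (ζ - z)⁻¹ • R) + ∮ ζ in C(z, r), R * resolventOp T ζ :=
      circleIntegral.integral_add hint₁ hint₂
    _ = _ := by
      rw [circleIntegral.integral_smul_const, circleIntegral.integral_sub_center_inv z hr.ne']
      exact congrArg _ (map_circleIntegral (ContinuousLinearMap.mul ℂ (X →L[ℂ] X) R)
        (circleIntegrable_resolventOp hr hz)).symm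
  rw [reducedResolvent, mul_smul_comm, hintegral, smul_add, inv_smul_smul₀ Complex.two_pi_I_ne_zero,
    rieszProjection, mul_neg, mul_smul_comm, sub_neg_eq_add]

theorem exists_commute_pencil_mul_eq_one_sub_rieszProjection (h : IsBoundedInverse T w R)
    (hr : 0 < r) (hz : Metric.closedBall z r \ {z} ⊆ rho T) :
    ∃ L, Commute (pencil R w z) L ∧ pencil R w z * L = 1 - rieszProjection T z r := by
  refine ⟨1 - rieszProjection T z r + (z - w) • reducedResolvent T z r,
    ((Commute.one_right _).sub_right (h.commute_pencil_rieszProjection hr hz)).add_right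
      ((h.commute_pencil_reducedResolvent hr hz).smul_right _), ?_⟩
  rw [mul_add, mul_smul_comm, h.pencil_mul_reducedResolvent hr hz, pencil, sub_mul, one_mul,
    smul_mul_assoc, mul_sub, mul_one, sub_add_cancel]

end IsBoundedInverse

end RieszProjection

section EssentialSpectrum

variable {X : Type*} [NormedAddCommGroup X] [NormedSpace ℂ X] {T : X →ₗ.[ℂ] X} {z : ℂ}

theorem not_accPt_sigma_iff : ¬ AccPt z (𝓟 (sigma T)) ↔ ∀ᶠ w in 𝓝[≠] z, w ∈ rho T := by
  rw [accPt_iff_frequently_nhdsNE, not_frequently]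
  simp only [sigma, Set.mem_compl_iff, not_not]

theorem exists_closedBall_diff_subset_rho (h : ∀ᶠ w in 𝓝[≠] z, w ∈ rho T) :
    ∃ r : ℝ, 0 < r ∧ Metric.closedBall z r \ {z} ⊆ rho T := by
  rw [eventually_nhdsWithin_iff] at h
  obtain ⟨r, hr, hball⟩ := Metric.nhds_basis_closedBall.eventually_iff.1 h
  exact ⟨r, hr, fun w hw => hball hw.1 hw.2⟩

theorem HasFiniteAlgMult.eventually_mem_rho (h : HasFiniteAlgMult T z) :
    ∀ᶠ w in 𝓝[≠] z, w ∈ rho T := by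
  obtain ⟨r, hr, hball, -⟩ := h
  rw [eventually_nhdsWithin_iff]
  filter_upwards [Metric.closedBall_mem_nhds z hr] with w hw hwz
  exact hball ⟨hw, hwz⟩

variable [CompleteSpace X]

theorem IsFredholmAt.finiteDimensional_genKer (hF : IsFredholmAt T z)
    (h : ∀ᶠ w in 𝓝[≠] z, w ∈ rho T) : FiniteDimensional ℂ (genKer T z) := by
  obtain ⟨w, R, hR⟩ := h.exists
  obtain ⟨hker, hrange⟩ := (hR.isFredholmAt_iff z).1 hF
  rw [hR.genKer_eq_hyperkernel]
  refine finiteDimensional_hyperkernel hrange (closure_mono ?_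
    (pencil_mem_closure_isUnit (h.mono fun ζ => hR.mem_rho_iff.1)))
  exact fun B hB => ⟨hB.1, (ContinuousLinearMap.isUnit_iff_bijective.1 hB.2).injective⟩

theorem IsBoundedInverse.isUnit_mapQL_pencil {w : ℂ} {R : X →L[ℂ] X} (hR : IsBoundedInverse T w R)
    (h : ∀ᶠ ζ in 𝓝[≠] z, ζ ∈ rho T) (hran : IsClosed (ran T z : Set X))
    [FiniteDimensional ℂ (hyperkernel (pencil R w z).toLinearMap)] :
    IsUnit (mapQL _ (pencil R w z) (hyperkernel_le_comap (Commute.refl _))) := by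
  rw [hR.ran_eq_range] at hran
  refine isUnit_mapQL_hyperkernel hran (closure_mono ?_
    (pencil_mem_closure_isUnit (h.mono fun ζ => hR.mem_rho_iff.1)))
  exact fun B hB => ⟨hB.1, (ContinuousLinearMap.isUnit_iff_bijective.1 hB.2).surjective⟩

theorem isFredholmAt_and_indexAt_eq_zero_of_finiteDimensional_genKer
    (h : ∀ᶠ w in 𝓝[≠] z, w ∈ rho T) (hran : IsClosed (ran T z : Set X))
    (hgen : FiniteDimensional ℂ (genKer T z)) :
    IsFredholmAt T z ∧ indexAt T z = 0 := by
  obtain ⟨w, R, hR⟩ := h.exists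
  rw [hR.genKer_eq_hyperkernel] at hgen
  set N := hyperkernel (pencil R w z).toLinearMap
  have : IsClosed (N : Set X) := N.closed_of_finiteDimensional
  have hN : N ≤ N.comap (pencil R w z).toLinearMap := hyperkernel_le_comap (Commute.refl _)
  have hbij : Function.Bijective (N.mapQ N (pencil R w z).toLinearMap hN) :=
    ContinuousLinearMap.isUnit_iff_bijective.1 (hR.isUnit_mapQL_pencil h hran)
  rw [hR.isFredholmAt_iff, hR.indexAt_eq_index]
  exact ⟨⟨Submodule.finiteDimensional_of_le (ker_le_of_injective_mapQ hbij.injective),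
    cofg_range_of_surjective_mapQ hbij.surjective⟩, index_eq_zero_of_bijective_mapQ hbij⟩

theorem hasFiniteAlgMult_of_finiteDimensional_genKer (h : ∀ᶠ w in 𝓝[≠] z, w ∈ rho T)
    (hran : IsClosed (ran T z : Set X)) (hgen : FiniteDimensional ℂ (genKer T z)) :
    HasFiniteAlgMult T z := by
  obtain ⟨w, R, hR⟩ := h.exists
  rw [hR.genKer_eq_hyperkernel] at hgen
  obtain ⟨r, hr, hball⟩ := exists_closedBall_diff_subset_rho h
  exact ⟨r, hr, hball, Submodule.finiteDimensional_of_le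
    (hR.range_rieszProjection_le_hyperkernel hr hball (Submodule.closed_of_finiteDimensional _)
      (hR.isUnit_mapQL_pencil h hran))⟩

theorem HasFiniteAlgMult.isClosed_ran (h : HasFiniteAlgMult T z) :
    IsClosed (ran T z : Set X) := by
  obtain ⟨w, R, hR⟩ := h.eventually_mem_rho.exists
  obtain ⟨r, hr, hball, hfin⟩ := h
  obtain ⟨L, -, hL⟩ := hR.exists_commute_pencil_mul_eq_one_sub_rieszProjection hr hball
  rw [hR.ran_eq_range]
  exact isClosed_range_of_cofg
    (cofg_range_of_mul_eq_one_sub (congrArg ContinuousLinearMap.toLinearMap hL))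

theorem HasFiniteAlgMult.finiteDimensional_genKer (h : HasFiniteAlgMult T z) :
    FiniteDimensional ℂ (genKer T z) := by
  obtain ⟨w, R, hR⟩ := h.eventually_mem_rho.exists
  obtain ⟨r, hr, hball, hfin⟩ := h
  obtain ⟨L, hcomm, hL⟩ := hR.exists_commute_pencil_mul_eq_one_sub_rieszProjection hr hball
  rw [hR.genKer_eq_hyperkernel]
  exact Submodule.finiteDimensional_of_le
    (hyperkernel_le_range_of_mul_eq_one_sub (commute_toLinearMap hcomm.symm)
      (congrArg ContinuousLinearMap.toLinearMap (hcomm.symm.eq.trans hL)))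

theorem hasFiniteAlgMult_iff (h : ∀ᶠ w in 𝓝[≠] z, w ∈ rho T) :
    HasFiniteAlgMult T z ↔ IsFredholmAt T z ∧ indexAt T z = 0 := by
  constructor
  · intro hfin
    exact isFredholmAt_and_indexAt_eq_zero_of_finiteDimensional_genKer h hfin.isClosed_ran
      hfin.finiteDimensional_genKer
  · rintro ⟨hF, -⟩
    exact hasFiniteAlgMult_of_finiteDimensional_genKer h hF.1 (hF.finiteDimensional_genKer h)

theorem DeltaB_eq_Delta5 (T : X →ₗ.[ℂ] X) : DeltaB T = Delta5 T := by
  ext z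
  constructor
  · rintro ⟨-, hfin, hacc⟩
    have h := not_accPt_sigma_iff.1 hacc
    obtain ⟨hF, hindex⟩ := (hasFiniteAlgMult_iff h).1 hfin
    exact ⟨hF, hindex, h⟩
  · rintro ⟨hF, hindex, h⟩
    exact ⟨hF.1, (hasFiniteAlgMult_iff h).2 ⟨hF, hindex⟩, not_accPt_sigma_iff.2 h⟩

theorem DeltaB'_eq_Delta5 (T : X →ₗ.[ℂ] X) : DeltaB' T = Delta5 T := by
  ext z
  constructor
  · rintro ⟨hran, hgen, hacc⟩
    have h := not_accPt_sigma_iff.1 hacc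
    obtain ⟨hF, hindex⟩ := isFredholmAt_and_indexAt_eq_zero_of_finiteDimensional_genKer h hran hgen
    exact ⟨hF, hindex, h⟩
  · rintro ⟨hF, -, h⟩
    exact ⟨hF.1, hF.finiteDimensional_genKer h, not_accPt_sigma_iff.2 h⟩

theorem rho_subset_Delta5 (T : X →ₗ.[ℂ] X) : rho T ⊆ Delta5 T := by
  rintro z ⟨R, hR⟩
  have hbij : Function.Bijective (pencil R z z) :=
    ContinuousLinearMap.isUnit_iff_bijective.1 (hR.mem_rho_iff.1 ⟨R, hR⟩)
  refine ⟨(hR.isFredholmAt_iff z).2 ⟨?_, ?_⟩, ?_,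
    nhdsWithin_le_nhds ((isOpen_rho T).mem_nhds ⟨R, hR⟩)⟩
  · rw [LinearMap.ker_eq_bot.2 hbij.injective]
    infer_instance
  · rw [LinearMap.range_eq_top.2 hbij.surjective]
    exact .top
  · rw [hR.indexAt_eq_index]
    exact LinearEquiv.index_eq_zero (e := .ofBijective (pencil R z z).toLinearMap hbij)

theorem sigmaDisc_eq (T : X →ₗ.[ℂ] X) :
    sigmaDisc T = {z | z ∈ isolatedSpectrum T ∧ IsFredholmAt T z ∧ indexAt T z = 0} :=
  Set.ext fun _ => and_congr_right fun hz => hasFiniteAlgMult_iff (not_accPt_sigma_iff.1 hz.2)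

theorem sigmaEss5_eq (T : X →ₗ.[ℂ] X) : sigmaEss5 T = sigma T \ sigmaDisc T := by
  rw [sigmaDisc_eq]
  ext z
  constructor
  · intro hz
    refine ⟨fun hrho => hz (rho_subset_Delta5 T hrho), ?_⟩
    rintro ⟨⟨-, hacc⟩, hF, hindex⟩
    exact hz ⟨hF, hindex, not_accPt_sigma_iff.1 hacc⟩
  · rintro ⟨hz, hdisc⟩ ⟨hF, hindex, h⟩
    exact hdisc ⟨⟨hz, not_accPt_sigma_iff.2 h⟩, hF, hindex⟩

end EssentialSpectrum

end ClosedOperator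

theorem mainTheorem3_general {X : Type*} [NormedAddCommGroup X] [NormedSpace ℂ X] [CompleteSpace X]
    (T : X →ₗ.[ℂ] X) :
    ClosedOperator.sigmaDisc T =
        {z | z ∈ ClosedOperator.isolatedSpectrum T ∧ ClosedOperator.IsFredholmAt T z ∧
          ClosedOperator.indexAt T z = 0} ∧
      ClosedOperator.sigmaEss5 T = ClosedOperator.sigma T \ ClosedOperator.sigmaDisc T ∧
      ClosedOperator.sigmaEssB T = ClosedOperator.sigmaEss5 T ∧
      ClosedOperator.sigmaEssB' T = ClosedOperator.sigmaEss5 T :=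
  ⟨ClosedOperator.sigmaDisc_eq T, ClosedOperator.sigmaEss5_eq T,
    congrArg compl (ClosedOperator.DeltaB_eq_Delta5 T),
    congrArg compl (ClosedOperator.DeltaB'_eq_Delta5 T)⟩

theorem mainTheorem3 {X : Type*} [NormedAddCommGroup X] [NormedSpace ℂ X] [CompleteSpace X]
    (T : X →ₗ.[ℂ] X) (hT : T.IsClosed) :
    ClosedOperator.sigmaDisc T =
        {z | z ∈ ClosedOperator.isolatedSpectrum T ∧ ClosedOperator.IsFredholmAt T z ∧
          ClosedOperator.indexAt T z = 0} ∧
      ClosedOperator.sigmaEss5 T = ClosedOperator.sigma T \ ClosedOperator.sigmaDisc T ∧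
      ClosedOperator.sigmaEssB T = ClosedOperator.sigmaEss5 T ∧
      ClosedOperator.sigmaEssB' T = ClosedOperator.sigmaEss5 T :=
  mainTheorem3_general T
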